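/- **Graphs.** Fix $n,c_{\mathrm{in}}\in\mathbb N$. A graph on $n$ vertices is a pair $G=(A,X)$ of a symmetric adjacency matrix $A\in\mathbb R_{\ge 0}^{n\times n}$ (simple unweighted graphs are the case $A_{ij}\in\{0,1\}$, $A_{ii}=0$) and a matrix $X\in\mathbb R^{n\times c_{\mathrm{in}}}$ of input node features, with the Euclidean topology. Two graphs are isomorphic if a permutation of the vertices carries $A$ and $X$ of one to those of the other. **Random Feature Propagation (RFP), single trajectory.** The hyperparameters $\mathcal H$ are: integers $k,P,w\ge 1$; an embedding dimension $d$; a propagation operator $S=S(G)\in\{A,\ \tilde D^{-1/2}\tilde A\tilde D^{-1/2},\ \tilde D^{-1/2}(\tilde D-\tilde A)\tilde D^{-1/2}\}$, where $\tilde A=A+I$ and $\tilde D$ is the diagonal matrix of the row sums of $\tilde A$; a normalization $N$ of $n\times k$ matrices, which is either division of every column by its Euclidean norm or orthonormalization of the columns (Gram–Schmidt; zero, respectively linearly dependent, columns are sent to $0$); an activation $\sigma$ (identity or ReLU, entrywise); and the depths and widths of the network below. The weights $\mathcal W$ are a matrix $K$ with $d$ columns and the weights of the network; they do not depend on the graph.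 From $r\in\mathbb R^{n\times k}$ put $a^{(0)}=r$ and, for $1\le p\le P$, $a^{(p)}=N(Sa^{(p-1)})$ if $w\mid p$ and $a^{(p)}=Sa^{(p-1)}$ otherwise. Let $f^{(0)}=\sigma\big([X\,|\,a^{(0)}\,|\,a^{(1)}\,|\cdots|\,a^{(P)}]\,K\big)\in\mathbb R^{n\times d}$. Apply to $x^{(0)}=f^{(0)}$ a finite number $T$ of message-passing layers $$x_v^{(t+1)}=\mathrm{ReLU}\Big(W_1^{(t)}x_v^{(t)}+\sum_{u}A_{vu}W_2^{(t)}x_u^{(t)}+b^{(t)}\Big),$$ and output $y_G=y_G(r)=\psi\big(\sum_v x_v^{(T)}\big)\in\mathbb R$, where $\psi$ is a ReLU multilayer perceptron with an affine output layer. **Proposition (universal approximation).** Let $\Omega_n$ be a compact set of graphs on $n$ vertices, and let $f:\Omega_n\to\mathbb R$ be a continuous graph function, i.e. continuous and equal on any two isomorphic elements of $\Omega_n$. Let $\mathcal D$ be a continuous (atomless) probability distribution on $\mathbb R$ with bounded support, zero mean and finite variance $c$, and let the random node features $r\in\mathbb R^{n\times k}$ have independent entries with distribution $\mathcal D$. Then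 for all $\varepsilon,\delta>0$ there is a choice of hyperparameters $\mathcal H$ and weights $\mathcal W$ such that $$\forall G\in\Omega_n:\qquad \Pr\big(|f(G)-y_G|\le\varepsilon\big)\ \ge\ 1-\delta .$$ -/

import Mathlib

open MeasureTheory

noncomputable section

namespace RFP

/-- Undirected graphs on the vertex set `Fin n` with `cin` channels of input node features: pairs
`(A, X)` of a symmetric adjacency matrix with nonnegative weights (the simple unweighted graphs
being those with weights in `{0, 1}` and zero diagonal) and a matrix of node features, with the
Euclidean topology. -/
abbrev AttrGraph (n cin : ℕ) : Type :=
  {G : Matrix (Fin n) (Fin n) ℝ × Matrix (Fin n) (Fin cin) ℝ //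
    G.1.IsSymm ∧ ∀ i j, 0 ≤ G.1 i j}

variable {n cin k d e m : ℕ}

/-- The adjacency matrix of a graph. -/
def AttrGraph.adj (G : AttrGraph n cin) : Matrix (Fin n) (Fin n) ℝ := G.1.1

/-- The input node features of a graph. -/
def AttrGraph.feat (G : AttrGraph n cin) : Matrix (Fin n) (Fin cin) ℝ := G.1.2

/-- Two graphs are isomorphic if a relabelling of the vertices carries the adjacency matrix and
the node features of one to those of the other. -/
def AttrGraph.Isomorphic (G G' : AttrGraph n cin) : Prop :=
  ∃ π : Equiv.Perm (Fin n),
    (∀ i j, G'.adj (π i) (π j) = G.adj i j) ∧ ∀ i l, G'.feat (π i) l = G.feat i l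

/-! ### Propagation operators -/

/-- The adjacency matrix with added self-loops. -/
def AttrGraph.loopAdj (G : AttrGraph n cin) : Matrix (Fin n) (Fin n) ℝ := G.adj + 1

/-- The degree of a vertex, self-loop included; it is at least `1`. -/
def AttrGraph.loopDeg (G : AttrGraph n cin) (i : Fin n) : ℝ := ∑ j, G.loopAdj i j

/-- The diagonal matrix of the inverse square roots of the degrees. -/
def AttrGraph.invSqrtDeg (G : AttrGraph n cin) : Matrix (Fin n) (Fin n) ℝ :=
  Matrix.diagonal fun i => (Real.sqrt (G.loopDeg i))⁻¹

/-- The predefined propagation operators: the adjacency matrix, and the symmetrically normalized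
adjacency matrix and Laplacian (with self-loops). -/
inductive Operator : Type
  | adjacency
  | normAdjacency
  | normLaplacian

/-- The matrix of a propagation operator on a given graph. -/
def Operator.matrix (G : AttrGraph n cin) : Operator → Matrix (Fin n) (Fin n) ℝ
  | .adjacency => G.adj
  | .normAdjacency => G.invSqrtDeg * G.loopAdj * G.invSqrtDeg
  | .normLaplacian => G.invSqrtDeg * (Matrix.diagonal G.loopDeg - G.loopAdj) * G.invSqrtDeg

/-! ### Normalization functions -/

/-- The normalization functions: channel-wise `ℓ²` normalization and orthonormalization. -/
inductive Normalization : Type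
  | l2
  | qr

/-- Channel-wise `ℓ²` normalization (a zero column stays zero). -/
def l2Normalize (a : Matrix (Fin n) (Fin k) ℝ) : Matrix (Fin n) (Fin k) ℝ :=
  Matrix.of fun i j => a i j / Real.sqrt (∑ i', a i' j ^ 2)

/-- Orthonormalization of the columns by the Gram-Schmidt process (a column that depends linearly
on the previous ones becomes zero). -/
def qrNormalize (a : Matrix (Fin n) (Fin k) ℝ) : Matrix (Fin n) (Fin k) ℝ :=
  Matrix.of fun i j =>
    (InnerProductSpace.gramSchmidtNormed ℝ
      (fun j' : Fin k => (WithLp.toLp 2 fun i' => a i' j' : EuclideanSpace ℝ (Fin n))) j) i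

/-- The function that a normalization stands for. -/
def Normalization.apply :
    Normalization → Matrix (Fin n) (Fin k) ℝ → Matrix (Fin n) (Fin k) ℝ
  | .l2 => l2Normalize
  | .qr => qrNormalize

/-! ### The trajectory -/

/-- The features after `p` propagation steps from the random features `r`, normalized at every
step whose number is divisible by `w`. -/
def propagate (S : Matrix (Fin n) (Fin n) ℝ)
    (N : Matrix (Fin n) (Fin k) ℝ → Matrix (Fin n) (Fin k) ℝ) (w : ℕ)
    (r : Matrix (Fin n) (Fin k) ℝ) : ℕ → Matrix (Fin n) (Fin k) ℝ
  | 0 => r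
  | p + 1 =>
      if (p + 1) % w = 0 then N (S * propagate S N w r p) else S * propagate S N w r p

/-- The trajectory: the channel-wise concatenation of the random features and of the results of
the first `P` steps. -/
def trajectory (S : Matrix (Fin n) (Fin n) ℝ)
    (N : Matrix (Fin n) (Fin k) ℝ → Matrix (Fin n) (Fin k) ℝ) (w P : ℕ)
    (r : Matrix (Fin n) (Fin k) ℝ) : Matrix (Fin n) (Fin (P + 1) × Fin k) ℝ :=
  Matrix.of fun i q => propagate S N w r q.1 i q.2

/-! ### The downstream network -/

/-- The rectified linear unit. -/
def relu (x : ℝ) : ℝ := max x 0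

/-- The activation after the embedding layer, which is optional. -/
inductive Activation : Type
  | identity
  | relu

/-- The function that an activation stands for. -/
def Activation.apply : Activation → ℝ → ℝ
  | .identity => id
  | .relu => RFP.relu

/-- A stack of GraphConv layers (of any depth and widths) from `d` to `m` channels, with its
weights. -/
inductive GraphConv : ℕ → ℕ → Type
  | nil (d : ℕ) : GraphConv d d
  | cons {d e m : ℕ} (W₁ W₂ : Matrix (Fin e) (Fin d) ℝ) (b : Fin e → ℝ)
      (rest : GraphConv e m) : GraphConv d m

/-- One GraphConv layer: the vertex `v` gets the features
`relu (W₁ x_v + ∑_u A_{vu} W₂ x_u + b)`. -/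
def graphConvLayer (A : Matrix (Fin n) (Fin n) ℝ) (W₁ W₂ : Matrix (Fin e) (Fin d) ℝ)
    (b : Fin e → ℝ) (x : Matrix (Fin n) (Fin d) ℝ) : Matrix (Fin n) (Fin e) ℝ :=
  Matrix.of fun v l =>
    relu ((W₁.mulVec (x v)) l + (∑ u, A v u * (W₂.mulVec (x u)) l) + b l)

/-- The function computed by a stack of GraphConv layers on the graph with adjacency matrix
`A`. -/
def GraphConv.apply (A : Matrix (Fin n) (Fin n) ℝ) {d m : ℕ} :
    GraphConv d m → Matrix (Fin n) (Fin d) ℝ → Matrix (Fin n) (Fin m) ℝ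
  | .nil _, x => x
  | .cons W₁ W₂ b rest, x => rest.apply A (graphConvLayer A W₁ W₂ b x)

/-- A multilayer perceptron with ReLU hidden layers (in any number and of any widths) and an
affine output layer, with its weights. -/
inductive MLP : ℕ → ℕ → Type
  | output {d m : ℕ} (W : Matrix (Fin m) (Fin d) ℝ) (b : Fin m → ℝ) : MLP d m
  | hidden {d e m : ℕ} (W : Matrix (Fin e) (Fin d) ℝ) (b : Fin e → ℝ) (rest : MLP e m) : MLP d m

/-- The function computed by a multilayer perceptron. -/
def MLP.apply {d m : ℕ} : MLP d m → (Fin d → ℝ) → (Fin m → ℝ)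
  | .output W b, x => W.mulVec x + b
  | .hidden W b rest, x => rest.apply fun l => relu ((W.mulVec x + b) l)

/-- A message-passing network with graph-level scalar output on `d` input channels: GraphConv
layers, a sum over the vertices, and a multilayer perceptron. -/
structure MPNN (d : ℕ) where
  /-- the number of channels after the last message-passing layer -/
  width : ℕ
  /-- the message-passing layers -/
  layers : GraphConv d width
  /-- the perceptron applied to the summed features -/
  readout : MLP width 1

/-- The output of a message-passing network on a graph with node features `x`. -/
def MPNN.apply (g : MPNN d) (A : Matrix (Fin n) (Fin n) ℝ) (x : Matrix (Fin n) (Fin d) ℝ) : ℝ :=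
  g.readout.apply (fun l => ∑ v, g.layers.apply A x v l) 0

/-! ### The algorithm -/

/-- The hyperparameters of random feature propagation with a single trajectory. The depth and the
widths of the downstream network are carried by the type `MPNN`. -/
structure Hyperparameters where
  /-- the propagation operator -/
  op : Operator
  /-- the normalization function -/
  normalization : Normalization
  /-- one step in `w` is normalized -/
  w : ℕ
  /-- the number of propagation steps -/
  P : ℕ
  /-- the number of channels of random features -/
  k : ℕ
  /-- the number of channels after the embedding layer -/
  d : ℕ
  /-- the activation after the embedding layer -/
  σ : Activation
  w_pos : 1 ≤ w
  P_pos : 1 ≤ P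
  k_pos : 1 ≤ k

/-- The weights: the linear embedding layer and the downstream network. They do not depend on the
graph. -/
structure Weights (cin : ℕ) (H : Hyperparameters) where
  /-- the matrix of the linear embedding layer -/
  embed : Matrix (Fin cin ⊕ Fin (H.P + 1) × Fin H.k) (Fin H.d) ℝ
  /-- the downstream network -/
  gnn : MPNN H.d

/-- The initial node embeddings `σ (K (f_in ⊕ t))`, where `t` is the trajectory of `r`. -/
def initialEmbedding (H : Hyperparameters) (W : Weights cin H) (G : AttrGraph n cin)
    (r : Matrix (Fin n) (Fin H.k) ℝ) : Matrix (Fin n) (Fin H.d) ℝ :=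
  (Matrix.fromCols G.feat
    (trajectory (H.op.matrix G) H.normalization.apply H.w H.P r) * W.embed).map H.σ.apply

/-- The output of random feature propagation on the graph `G` for the random features `r`. -/
def output (H : Hyperparameters) (W : Weights cin H) (G : AttrGraph n cin)
    (r : Matrix (Fin n) (Fin H.k) ℝ) : ℝ :=
  W.gnn.apply G.adj (initialEmbedding H W G r)

/-- The law of `n × k` random node features with independent entries of law `μ`. -/
def featureLaw (μ : Measure ℝ) (n k : ℕ) : Measure (Fin n → Fin k → ℝ) :=
  Measure.pi fun _ => Measure.pi fun _ => μ

end RFP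

end

open MeasureTheory

noncomputable section

namespace RFP

/-! Message passing alone cannot tell all non-isomorphic graphs apart, but it can once the vertices
carry pairwise distinct numbers: a vertex is then singled out by its label, and its features and
edge weights can be read off. Random features supply such labels, and no propagation is needed.

Independent entries of an atomless bounded law are almost surely distinct, so with probability at
least `1 - δ` they lie in a compact set on which they are `η` apart (`exists_separatedFeatures`). On
the product of `Ω` with this set, `f`, regarded as independent of the labels, is continuous and
isomorphism invariant. The functions generated by the network operations form a lattice, since ReLU
yields maxima and minima, so the lattice form of Stone-Weierstrass reduces uniform approximation to
interpolation at two points. That follows from `exists_perm_of_graphFunction_eq`: points that no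
generated function separates are isomorphic. Finally `GraphFunction.exists_mpnn` realizes every
generated function exactly by one network, whose error bound holds for all graphs on the same event
of labels. -/

/-! ### Lattice approximation -/

/-- The lattice form of the Stone-Weierstrass theorem for a single target function: a set of
continuous functions closed under maxima and minima that interpolates `f` at any two points
approximates `f` uniformly. -/
theorem exists_uniform_approx_of_lattice {Y : Type*} [TopologicalSpace Y] [CompactSpace Y]
    (L : Set (Y → ℝ)) (hc : ∀ g ∈ L, Continuous g)
    (hsup : ∀ g ∈ L, ∀ g' ∈ L, (fun y => max (g y) (g' y)) ∈ L)
    (hinf : ∀ g ∈ L, ∀ g' ∈ L, (fun y => min (g y) (g' y)) ∈ L)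
    (f : Y → ℝ) (hf : Continuous f)
    (hint : ∀ x y, ∃ g ∈ L, g x = f x ∧ g y = f y) (hL : L.Nonempty)
    {ε : ℝ} (hε : 0 < ε) : ∃ g ∈ L, ∀ y, |f y - g y| ≤ ε := by
  -- A finite maximum of interpolants exact at `x` is still exact at `x`; compactness enters as
  -- induction over the sets on which the lower bound holds.
  have above : ∀ x, ∃ g ∈ L, g x = f x ∧ ∀ z ∈ (Set.univ : Set Y), f z - ε < g z := by
    intro x
    refine isCompact_univ.induction_on (p := fun s => ∃ g ∈ L, g x = f x ∧ ∀ z ∈ s, f z - ε < g z)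
      ?_ ?_ ?_ ?_
    · obtain ⟨g, hg, h1, -⟩ := hint x x
      exact ⟨g, hg, h1, by simp⟩
    · rintro s t hst ⟨g, hg, h1, h2⟩
      exact ⟨g, hg, h1, fun z hz => h2 z (hst hz)⟩
    · rintro s t ⟨g, hg, h1, h2⟩ ⟨g', hg', h1', h2'⟩
      refine ⟨_, hsup g hg g' hg', by simp [h1, h1'], ?_⟩
      rintro z (hz | hz)
      · exact lt_max_of_lt_left (h2 z hz)
      · exact lt_max_of_lt_right (h2' z hz)
    · intro y _
      obtain ⟨g, hg, h1, h2⟩ := hint x y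
      refine ⟨{z | f z - ε < g z}, mem_nhdsWithin_of_mem_nhds ?_, g, hg, h1, fun z hz => hz⟩
      exact (isOpen_lt (hf.sub continuous_const) (hc g hg)).mem_nhds
        (show f y - ε < g y by linarith)
  rcases isEmpty_or_nonempty Y with hY | ⟨⟨x₀⟩⟩
  · obtain ⟨g, hg⟩ := hL
    exact ⟨g, hg, fun y => hY.elim y⟩
  -- Each function from `above` is also below `f + ε` near its own base point; finite minima keep
  -- the global lower bound.
  have both : ∃ g ∈ L, (∀ z, f z - ε < g z) ∧ ∀ z ∈ (Set.univ : Set Y), g z < f z + ε := by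
    refine isCompact_univ.induction_on
      (p := fun s => ∃ g ∈ L, (∀ z, f z - ε < g z) ∧ ∀ z ∈ s, g z < f z + ε) ?_ ?_ ?_ ?_
    · obtain ⟨g, hg, -, h2⟩ := above x₀
      exact ⟨g, hg, fun z => h2 z trivial, by simp⟩
    · rintro s t hst ⟨g, hg, h1, h2⟩
      exact ⟨g, hg, h1, fun z hz => h2 z (hst hz)⟩
    · rintro s t ⟨g, hg, h1, h2⟩ ⟨g', hg', h1', h2'⟩
      refine ⟨_, hinf g hg g' hg', fun z => lt_min (h1 z) (h1' z), ?_⟩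
      rintro z (hz | hz)
      · exact min_lt_of_left_lt (h2 z hz)
      · exact min_lt_of_right_lt (h2' z hz)
    · intro y _
      obtain ⟨g, hg, h1, h2⟩ := above y
      refine ⟨{z | g z < f z + ε}, mem_nhdsWithin_of_mem_nhds ?_, g, hg, fun z => h2 z trivial,
        fun z hz => hz⟩
      exact (isOpen_lt (hc g hg) (hf.add continuous_const)).mem_nhds
        (show g y < f y + ε by linarith)
  obtain ⟨g, hg, h1, h2⟩ := both
  refine ⟨g, hg, fun y => abs_le.2 ⟨?_, ?_⟩⟩
  · linarith [h2 y trivial]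
  · linarith [h1 y]

/-! ### Functions generated by the operations of a network -/

section Generated

variable {C : Type*} {n d : ℕ}

/-- The vertex functions obtained from the input channels by linear combinations, rectification
and aggregation over neighbours. -/
inductive NodeFunction (A : C → Matrix (Fin n) (Fin n) ℝ) (x : C → Matrix (Fin n) (Fin d) ℝ) :
    (C × Fin n → ℝ) → Prop
  | channel (l : Fin d) : NodeFunction A x fun y => x y.1 y.2 l
  | const (a : ℝ) : NodeFunction A x fun _ => a
  | add {g h : C × Fin n → ℝ} : NodeFunction A x g → NodeFunction A x h →
      NodeFunction A x fun y => g y + h y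
  | smul (a : ℝ) {h : C × Fin n → ℝ} : NodeFunction A x h → NodeFunction A x fun y => a * h y
  | relu {h : C × Fin n → ℝ} : NodeFunction A x h → NodeFunction A x fun y => relu (h y)
  | agg {h : C × Fin n → ℝ} : NodeFunction A x h →
      NodeFunction A x fun y => ∑ u, A y.1 y.2 u * h (y.1, u)

/-- The graph functions obtained from sums of vertex functions by linear combinations and
rectification. -/
inductive GraphFunction (A : C → Matrix (Fin n) (Fin n) ℝ) (x : C → Matrix (Fin n) (Fin d) ℝ) :
    (C → ℝ) → Prop
  | sum {h : C × Fin n → ℝ} : NodeFunction A x h → GraphFunction A x fun c => ∑ v, h (c, v)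
  | const (a : ℝ) : GraphFunction A x fun _ => a
  | add {g h : C → ℝ} : GraphFunction A x g → GraphFunction A x h →
      GraphFunction A x fun c => g c + h c
  | smul (a : ℝ) {h : C → ℝ} : GraphFunction A x h → GraphFunction A x fun c => a * h c
  | relu {h : C → ℝ} : GraphFunction A x h → GraphFunction A x fun c => relu (h c)

variable {A : C → Matrix (Fin n) (Fin n) ℝ} {x : C → Matrix (Fin n) (Fin d) ℝ}

theorem NodeFunction.sub {g h : C × Fin n → ℝ} (hg : NodeFunction A x g)
    (hh : NodeFunction A x h) : NodeFunction A x fun y => g y - h y := by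
  simpa [sub_eq_add_neg] using hg.add (hh.smul (-1))

theorem GraphFunction.sub {g h : C → ℝ} (hg : GraphFunction A x g)
    (hh : GraphFunction A x h) : GraphFunction A x fun y => g y - h y := by
  simpa [sub_eq_add_neg] using hg.add (hh.smul (-1))

theorem GraphFunction.max {g h : C → ℝ} (hg : GraphFunction A x g)
    (hh : GraphFunction A x h) : GraphFunction A x fun y => max (g y) (h y) := by
  have : (fun y => Max.max (g y) (h y)) = fun y => h y + RFP.relu (g y - h y) := by
    funext y
    rw [RFP.relu, ← max_add_add_left]
    simp
  rw [this]
  exact hh.add (hg.sub hh).relu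

theorem GraphFunction.min {g h : C → ℝ} (hg : GraphFunction A x g)
    (hh : GraphFunction A x h) : GraphFunction A x fun y => min (g y) (h y) := by
  have : (fun y => Min.min (g y) (h y)) = fun y => g y - RFP.relu (g y - h y) := by
    funext y
    rw [RFP.relu, ← min_sub_sub_left]
    simp [min_comm]
  rw [this]
  exact hg.sub (hg.sub hh).relu

theorem continuous_relu : Continuous relu := continuous_id.max continuous_const

theorem NodeFunction.continuous [TopologicalSpace C] (hA : Continuous A) (hx : Continuous x)
    {h : C × Fin n → ℝ} (hh : NodeFunction A x h) (v : Fin n) : Continuous fun c => h (c, v) := by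
  induction hh generalizing v with
  | channel l => exact hx.matrix_elem v l
  | const a => exact continuous_const
  | add _ _ h1 h2 => exact (h1 v).add (h2 v)
  | smul a _ h1 => exact continuous_const.mul (h1 v)
  | relu _ h1 => exact continuous_relu.comp (h1 v)
  | agg _ h1 => exact continuous_finsetSum _ fun u _ => (hA.matrix_elem v u).mul (h1 u)

theorem GraphFunction.continuous [TopologicalSpace C] (hA : Continuous A) (hx : Continuous x)
    {h : C → ℝ} (hh : GraphFunction A x h) : Continuous h := by
  induction hh with
  | sum h1 => exact continuous_finsetSum _ fun v _ => h1.continuous hA hx v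
  | const a => exact continuous_const
  | add _ _ h1 h2 => exact h1.add h2
  | smul a _ h1 => exact continuous_const.mul h1
  | relu _ h1 => exact continuous_relu.comp h1

/-! ### Separation of graphs with distinct labels -/

/-- The indicator function of a value of a vertex function agrees, at two given points, with a
vertex function. -/
theorem NodeFunction.exists_indicator {ρ : C × Fin n → ℝ} (hρ : NodeFunction A x ρ) (p q : C)
    (s : ℝ) : ∃ h, NodeFunction A x h ∧ (∀ v, h (p, v) = if ρ (p, v) = s then 1 else 0) ∧
      ∀ v, h (q, v) = if ρ (q, v) = s then 1 else 0 := by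
  -- There are finitely many vertices, so one slope `a` clears all labels different from `s`, at
  -- both points.
  have key : ∀ c : C, ∀ᶠ a : ℝ in Filter.atTop, ∀ v, ρ (c, v) ≠ s → 1 ≤ a * |ρ (c, v) - s| := by
    intro c
    refine Filter.eventually_all.2 fun v => ?_
    by_cases hv : ρ (c, v) = s
    · simp [hv]
    · have h0 : 0 < |ρ (c, v) - s| := abs_pos.2 (sub_ne_zero.2 hv)
      filter_upwards [(Filter.tendsto_id.atTop_mul_const h0).eventually_ge_atTop 1] with a ha _
      exact ha
  obtain ⟨a, hp, hq⟩ := ((key p).and (key q)).exists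
  -- A hat function around `s`, with `|ρ - s|` written as a sum of two ReLUs.
  refine ⟨fun y => RFP.relu (1 - a * (RFP.relu (ρ y - s) + RFP.relu (s - ρ y))),
    ((NodeFunction.const 1).sub (((hρ.sub (.const s)).relu.add
      ((NodeFunction.const s).sub hρ).relu).smul a)).relu, ?_⟩
  have habs : ∀ t : ℝ, RFP.relu (t - s) + RFP.relu (s - t) = |t - s| := by
    intro t
    unfold RFP.relu
    rcases le_total t s with h | h
    · rw [max_eq_right (by linarith), max_eq_left (by linarith), abs_of_nonpos (by linarith)]
      ring
    · rw [max_eq_left (by linarith), max_eq_right (by linarith), abs_of_nonneg (by linarith)]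
      ring
  have fin : ∀ t : ℝ, (t ≠ s → 1 ≤ a * |t - s|) →
      RFP.relu (1 - a * |t - s|) = if t = s then 1 else 0 := by
    intro t ht
    split_ifs with h
    · simp [h, RFP.relu]
    · exact max_eq_right (by linarith [ht h])
  simp only [habs]
  exact ⟨fun v => fin _ (hp v), fun v => fin _ (hq v)⟩

/-- A vertex function cut off outside a level set of another agrees, at two given points, with a
vertex function. -/
theorem NodeFunction.exists_restrict {ρ h : C × Fin n → ℝ} (hρ : NodeFunction A x ρ)
    (hh : NodeFunction A x h) (p q : C) (s : ℝ) :
    ∃ g, NodeFunction A x g ∧ (∀ v, g (p, v) = if ρ (p, v) = s then h (p, v) else 0) ∧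
      ∀ v, g (q, v) = if ρ (q, v) = s then h (q, v) else 0 := by
  obtain ⟨β, hβ, hp, hq⟩ := hρ.exists_indicator p q s
  have key : ∀ c : C, ∀ᶠ B : ℝ in Filter.atTop, ∀ v, |h (c, v)| ≤ B := fun c =>
    Filter.eventually_all.2 fun v => Filter.eventually_ge_atTop _
  obtain ⟨B, hBp, hBq⟩ := ((key p).and (key q)).exists
  -- A ReLU substitute for the product `β * h` when `|h| ≤ B`: for `β = 1` the argument is `h + B ≥
  -- 0`, for `β = 0` it is `h - B ≤ 0`.
  refine ⟨fun y => RFP.relu (h y + 2 * B * β y - B) - B * β y,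
    ((hh.add (hβ.smul (2 * B))).sub (.const B)).relu.sub (hβ.smul B), ?_, ?_⟩
  · intro v
    have := abs_le.1 (hBp v)
    simp only [hp, RFP.relu]
    split_ifs
    · rw [max_eq_left (by linarith)]; ring
    · rw [max_eq_right (by linarith)]; ring
  · intro v
    have := abs_le.1 (hBq v)
    simp only [hq, RFP.relu]
    split_ifs
    · rw [max_eq_left (by linarith)]; ring
    · rw [max_eq_right (by linarith)]; ring

/-- If no graph function distinguishes two points at which the vertices carry distinct labels,
then a relabelling of the vertices carries the one point to the other. -/
theorem exists_perm_of_graphFunction_eq {ρ : C × Fin n → ℝ} (hρ : NodeFunction A x ρ) {p q : C}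
    (hp : Function.Injective fun v => ρ (p, v)) (hq : Function.Injective fun v => ρ (q, v))
    (heq : ∀ g, GraphFunction A x g → g p = g q) :
    ∃ π : Equiv.Perm (Fin n), (∀ i j, A q (π i) (π j) = A p i j) ∧
      ∀ i l, x q (π i) l = x p i l := by
  have hsum : ∀ {h}, NodeFunction A x h → ∀ s,
      (∑ v, if ρ (p, v) = s then h (p, v) else 0) = ∑ v, if ρ (q, v) = s then h (q, v) else 0 := by
    intro h hh s
    obtain ⟨g, hg, h1, h2⟩ := hρ.exists_restrict hh p q s
    simpa [h1, h2] using heq _ (GraphFunction.sum hg)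
  -- Restricting the constant `1` to a level set counts the vertices with that label, and the counts
  -- at `p` and `q` agree.
  have hmatch : ∀ v, ∃ w, ρ (q, w) = ρ (p, v) := by
    intro v
    by_contra! hne
    have := hsum (.const 1) (ρ (p, v))
    rw [Finset.sum_eq_zero (s := Finset.univ)
      (f := fun w => if ρ (q, w) = ρ (p, v) then (1 : ℝ) else 0) fun w _ => if_neg (hne w),
      Finset.sum_eq_zero_iff_of_nonneg fun _ _ => by positivity] at this
    simpa using this v (Finset.mem_univ v)
  choose π hπ using hmatch
  have hinj : Function.Injective π := fun v w hvw => hp (by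
    change ρ (p, v) = ρ (p, w)
    rw [← hπ, ← hπ, hvw])
  have hsingle : ∀ {c : C}, Function.Injective (fun v => ρ (c, v)) → ∀ (k : Fin n → ℝ) (v : Fin n),
      (∑ w, if ρ (c, w) = ρ (c, v) then k w else 0) = k v := by
    intro c hc k v
    rw [Finset.sum_eq_single v]
    · simp
    · intro w _ hw
      exact if_neg fun h => hw (hc h)
    · simp
  have hval : ∀ {h}, NodeFunction A x h → ∀ v, h (q, π v) = h (p, v) := by
    intro h hh v
    have := hsum hh (ρ (p, v))
    rw [hsingle hp fun v => h (p, v), ← hπ, hsingle hq fun v => h (q, v)] at this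
    exact this.symm
  refine ⟨Equiv.ofBijective π (Finite.injective_iff_bijective.1 hinj), fun i j => ?_,
    fun i l => hval (.channel l) i⟩
  -- Aggregating the indicator of the label of `j` leaves a single edge weight: that to `j` at `p`,
  -- and that to `π j` at `q`.
  obtain ⟨β, hβ, h1, h2⟩ := hρ.exists_indicator p q (ρ (p, j))
  have := hval hβ.agg i
  simp only [h1, h2, mul_ite, mul_one, mul_zero] at this
  rw [hsingle hp, ← hπ, hsingle hq] at this
  exact this

/-! ### Networks computing the generated functions -/

/-- Composition of stacks of GraphConv layers. -/
def GraphConv.append : {d e m : ℕ} → GraphConv d e → GraphConv e m → GraphConv d m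
  | _, _, _, .nil _, g => g
  | _, _, _, .cons W₁ W₂ b rest, g => .cons W₁ W₂ b (rest.append g)

theorem GraphConv.apply_append {d e m : ℕ} (f : GraphConv d e) (g : GraphConv e m)
    (B : Matrix (Fin n) (Fin n) ℝ) (z : Matrix (Fin n) (Fin d) ℝ) :
    (f.append g).apply B z = g.apply B (f.apply B z) := by
  induction f with
  | nil d => rfl
  | cons W₁ W₂ b rest ih => exact ih g _

/-- The linear combinations of the channels of a vector-valued function. -/
def channelSpan {Y : Type*} {m : ℕ} (Φ : Y → Fin m → ℝ) : Submodule ℝ (Y → ℝ) :=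
  Submodule.span ℝ (Set.range fun l y => Φ y l)

theorem mem_channelSpan {Y : Type*} {m : ℕ} {Φ : Y → Fin m → ℝ} {h : Y → ℝ} :
    h ∈ channelSpan Φ ↔ ∃ w : Fin m → ℝ, ∀ y, h y = ∑ l, w l * Φ y l := by
  rw [channelSpan, Submodule.mem_span_range_iff_exists_fun]
  refine exists_congr fun w => ⟨fun hw y => ?_, fun hw => ?_⟩
  · simp [← hw]
  · funext y
    simp [hw]

theorem channel_mem_channelSpan {Y : Type*} {m : ℕ} (Φ : Y → Fin m → ℝ) (l : Fin m) :
    (fun y => Φ y l) ∈ channelSpan Φ :=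
  Submodule.subset_span ⟨l, rfl⟩

theorem mem_channelSpan_cons {Y : Type*} {m : ℕ} (Φ : Y → Fin m → ℝ) (a : Y → ℝ) :
    a ∈ channelSpan (m := m + 1) fun y => Fin.cons (a y) (Φ y) :=
  channel_mem_channelSpan (m := m + 1) (fun y => Fin.cons (a y) (Φ y)) 0

theorem channelSpan_le_cons {Y : Type*} {m : ℕ} (Φ : Y → Fin m → ℝ) (a : Y → ℝ) :
    channelSpan Φ ≤ channelSpan (m := m + 1) fun y => Fin.cons (a y) (Φ y) := by
  rw [channelSpan, Submodule.span_le]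
  rintro _ ⟨l, rfl⟩
  exact channel_mem_channelSpan (m := m + 1) (fun y => Fin.cons (a y) (Φ y)) l.succ

/-- A nonnegative family of vertex features computed by a stack of GraphConv layers. -/
def IsNodeState (A : C → Matrix (Fin n) (Fin n) ℝ) (x : C → Matrix (Fin n) (Fin d) ℝ) {m : ℕ}
    (Φ : C × Fin n → Fin m → ℝ) : Prop :=
  (∃ L : GraphConv d m, ∀ c, L.apply (A c) (x c) = Matrix.of fun v => Φ (c, v)) ∧
    ∀ y l, 0 ≤ Φ y l

theorem relu_nonneg (t : ℝ) : 0 ≤ relu t := le_max_right _ _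

theorem relu_of_nonneg {t : ℝ} (ht : 0 ≤ t) : relu t = t := max_eq_left ht

theorem relu_sub_relu_neg (t : ℝ) : relu t - relu (-t) = t := by
  unfold relu
  rcases le_total 0 t with h | h
  · rw [max_eq_left h, max_eq_right (by linarith)]; ring
  · rw [max_eq_right h, max_eq_left (by linarith)]; ring

/-- The first layer splits each channel into positive and negative parts. Nonnegative channels pass
through later ReLU layers unchanged, and the difference of the two parts recovers the input. -/
theorem exists_isNodeState (A : C → Matrix (Fin n) (Fin n) ℝ) (x : C → Matrix (Fin n) (Fin d) ℝ) :
    ∃ Φ : C × Fin n → Fin (d + d) → ℝ, IsNodeState A x Φ ∧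
      ∀ l, (fun y : C × Fin n => x y.1 y.2 l) ∈ channelSpan Φ := by
  refine ⟨fun y => Fin.append (fun l => relu (x y.1 y.2 l)) fun l => relu (-x y.1 y.2 l),
    ⟨⟨.cons (Matrix.of (Fin.append (fun l => Pi.single l 1) fun l => Pi.single l (-1))) 0 0 (.nil _), ?_⟩, ?_⟩, ?_⟩
  · intro c
    ext v l
    refine Fin.addCases (fun l => ?_) (fun l => ?_) l
    · simp [GraphConv.apply, graphConvLayer, Matrix.mulVec]
    · simp [GraphConv.apply, graphConvLayer, Matrix.mulVec, -Fin.natAdd_eq_addNat]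
  · intro y l
    refine Fin.addCases (fun l => ?_) (fun l => ?_) l
    · simp [relu_nonneg]
    · simp [relu_nonneg, -Fin.natAdd_eq_addNat]
  · intro l
    set Φ : C × Fin n → Fin (d + d) → ℝ := fun y =>
      Fin.append (fun l => relu (x y.1 y.2 l)) fun l => relu (-x y.1 y.2 l) with hΦ
    have := (channelSpan Φ).sub_mem (channel_mem_channelSpan Φ (Fin.castAdd d l))
      (channel_mem_channelSpan Φ (Fin.natAdd d l))
    convert this using 1
    funext y
    simp [hΦ, relu_sub_relu_neg, -Fin.natAdd_eq_addNat]

/-- One more channel, computed by a GraphConv layer. -/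
theorem IsNodeState.cons {m : ℕ} {Φ : C × Fin n → Fin m → ℝ} (hΦ : IsNodeState A x Φ)
    {g h : C × Fin n → ℝ} (hg : g ∈ channelSpan Φ) (hh : h ∈ channelSpan Φ) (b : ℝ) :
    IsNodeState (m := m + 1) A x fun y =>
      Fin.cons (RFP.relu (g y + (∑ u, A y.1 y.2 u * h (y.1, u)) + b)) (Φ y) := by
  obtain ⟨⟨L, hL⟩, hpos⟩ := hΦ
  obtain ⟨w, hw⟩ := mem_channelSpan.1 hg
  obtain ⟨w', hw'⟩ := mem_channelSpan.1 hh
  -- The first row of the weights computes the new channel; the remaining rows copy the old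
  -- channels.
  refine ⟨⟨L.append (.cons (m := m + 1) (e := m + 1) (Matrix.of (Matrix.vecCons w fun l => Pi.single l 1))
    (Matrix.of (Matrix.vecCons w' 0)) (Matrix.vecCons b 0) (.nil _)), ?_⟩, ?_⟩
  · intro c
    rw [GraphConv.apply_append, hL]
    ext v l
    refine Fin.cases ?_ (fun l => ?_) l
    · simp [GraphConv.apply, graphConvLayer, Matrix.mulVec, dotProduct, hw, hw']
    · simp [GraphConv.apply, graphConvLayer, Matrix.mulVec, relu_of_nonneg (hpos _ _)]
  · intro y l
    refine Fin.cases ?_ (fun l => ?_) l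
    · simpa using relu_nonneg _
    · simpa using hpos y l

/-- Any vertex function is a combination of the channels of some extension of a given state. -/
theorem NodeFunction.exists_isNodeState {h : C × Fin n → ℝ} (hh : NodeFunction A x h) {m : ℕ}
    {Φ : C × Fin n → Fin m → ℝ} (hΦ : IsNodeState A x Φ)
    (hx : ∀ l, (fun y : C × Fin n => x y.1 y.2 l) ∈ channelSpan Φ) :
    ∃ (m' : ℕ) (Φ' : C × Fin n → Fin m' → ℝ), IsNodeState A x Φ' ∧
      channelSpan Φ ≤ channelSpan Φ' ∧ h ∈ channelSpan Φ' := by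
  induction hh generalizing m with
  | channel l => exact ⟨m, Φ, hΦ, le_rfl, hx l⟩
  | const a =>
    refine ⟨_, _, hΦ.cons (Submodule.zero_mem _) (Submodule.zero_mem _) 1,
      channelSpan_le_cons _ _, ?_⟩
    convert Submodule.smul_mem _ a (mem_channelSpan_cons Φ _) using 1
    funext y
    simp [RFP.relu]
  | add _ _ ih1 ih2 =>
    obtain ⟨m1, Φ1, hΦ1, hle1, h1⟩ := ih1 hΦ hx
    obtain ⟨m2, Φ2, hΦ2, hle2, h2⟩ := ih2 hΦ1 fun l => hle1 (hx l)
    exact ⟨m2, Φ2, hΦ2, hle1.trans hle2, Submodule.add_mem _ (hle2 h1) h2⟩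
  | smul a _ ih =>
    obtain ⟨m1, Φ1, hΦ1, hle1, h1⟩ := ih hΦ hx
    exact ⟨m1, Φ1, hΦ1, hle1, Submodule.smul_mem _ a h1⟩
  | relu _ ih =>
    obtain ⟨m1, Φ1, hΦ1, hle1, h1⟩ := ih hΦ hx
    refine ⟨_, _, hΦ1.cons h1 (Submodule.zero_mem _) 0,
      hle1.trans (channelSpan_le_cons _ _), ?_⟩
    convert mem_channelSpan_cons Φ1 _ using 1
    funext y
    simp
  -- The aggregate may be negative, so two layers store its positive and negative parts.
  | agg _ ih =>
    obtain ⟨m1, Φ1, hΦ1, hle1, h1⟩ := ih hΦ hx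
    have h2 := hΦ1.cons (Submodule.zero_mem _) h1 0
    have hle2 := channelSpan_le_cons Φ1
    refine ⟨_, _, h2.cons (Submodule.zero_mem _) (Submodule.neg_mem _ (hle2 _ h1)) 0,
      hle1.trans ((hle2 _).trans (channelSpan_le_cons _ _)), ?_⟩
    convert Submodule.sub_mem _ (channelSpan_le_cons _ _ (mem_channelSpan_cons Φ1 _))
      (mem_channelSpan_cons _ _) using 1
    funext y
    simp [relu_sub_relu_neg]

/-- A nonnegative family of graph features from which every perceptron can be evaluated by a
perceptron on the summed vertex features. -/
def IsGraphState {m m' : ℕ} (Φ : C × Fin n → Fin m → ℝ) (Ψ : C → Fin m' → ℝ) : Prop :=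
  (∀ g : MLP m' 1, ∃ g' : MLP m 1, ∀ c, g'.apply (fun l => ∑ v, Φ (c, v) l) = g.apply (Ψ c)) ∧
    ∀ c l, 0 ≤ Ψ c l

/-- One more channel, computed by a hidden layer of the perceptron. -/
theorem IsGraphState.cons {m m' : ℕ} {Φ : C × Fin n → Fin m → ℝ} {Ψ : C → Fin m' → ℝ}
    (hΨ : IsGraphState Φ Ψ) {g : C → ℝ} (hg : g ∈ channelSpan Ψ) (b : ℝ) :
    IsGraphState (m' := m' + 1) Φ fun c => Fin.cons (RFP.relu (g c + b)) (Ψ c) := by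
  obtain ⟨w, hw⟩ := mem_channelSpan.1 hg
  refine ⟨fun ψ => ?_, ?_⟩
  -- The new layer is put in front of `ψ`, and the longer perceptron is evaluated through the old
  -- state.
  · obtain ⟨g', hg'⟩ := hΨ.1 (.hidden
      (Matrix.of (Matrix.vecCons w fun l => Pi.single l 1)) (Matrix.vecCons b 0) ψ)
    refine ⟨g', fun c => ?_⟩
    rw [hg', MLP.apply]
    congr 1
    funext l
    refine Fin.cases ?_ (fun l => ?_) l
    · simp [dotProduct, hw]
    · simp [Matrix.mulVec, relu_of_nonneg (hΨ.2 _ _)]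
  · intro c l
    refine Fin.cases ?_ (fun l => ?_) l
    · simpa using relu_nonneg _
    · simpa using hΨ.2 c l

/-- For any graph function there is an extension of a given vertex state such that every graph
state over it can be extended to one with the function among the combinations of its channels. -/
theorem GraphFunction.exists_isGraphState {f : C → ℝ} (hf : GraphFunction A x f) {m : ℕ}
    {Φ : C × Fin n → Fin m → ℝ} (hΦ : IsNodeState A x Φ)
    (hx : ∀ l, (fun y : C × Fin n => x y.1 y.2 l) ∈ channelSpan Φ) :
    ∃ (m₁ : ℕ) (Φ₁ : C × Fin n → Fin m₁ → ℝ), IsNodeState A x Φ₁ ∧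
      channelSpan Φ ≤ channelSpan Φ₁ ∧
      ∀ (m₂ : ℕ) (Φ₂ : C × Fin n → Fin m₂ → ℝ), channelSpan Φ₁ ≤ channelSpan Φ₂ →
      ∀ (k : ℕ) (Ψ : C → Fin k → ℝ), IsGraphState Φ₂ Ψ →
        (channelSpan fun c l => ∑ v, Φ₂ (c, v) l) ≤ channelSpan Ψ →
        ∃ (k' : ℕ) (Ψ' : C → Fin k' → ℝ), IsGraphState Φ₂ Ψ' ∧
          channelSpan Ψ ≤ channelSpan Ψ' ∧ f ∈ channelSpan Ψ' := by
  induction hf generalizing m with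
  | @sum h hh =>
    obtain ⟨m₁, Φ₁, hΦ₁, hle, hmem⟩ := hh.exists_isNodeState hΦ hx
    refine ⟨m₁, Φ₁, hΦ₁, hle, fun m₂ Φ₂ hle₂ k Ψ hΨ hs => ⟨k, Ψ, hΨ, le_rfl, hs ?_⟩⟩
    obtain ⟨w, hw⟩ := mem_channelSpan.1 (hle₂ hmem)
    refine mem_channelSpan.2 ⟨w, fun c => ?_⟩
    simp only [hw, Finset.mul_sum]
    exact Finset.sum_comm
  | const a =>
    refine ⟨m, Φ, hΦ, le_rfl, fun m₂ Φ₂ _ k Ψ hΨ _ =>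
      ⟨_, _, hΨ.cons (Submodule.zero_mem _) 1, channelSpan_le_cons _ _, ?_⟩⟩
    convert Submodule.smul_mem _ a (mem_channelSpan_cons Ψ _) using 1
    funext y
    simp [RFP.relu]
  -- All vertex layers precede the readout, so the vertex state is extended for both summands first.
  -- This is why the induction hypothesis allows any later `Φ₂`.
  | add _ _ ih1 ih2 =>
    obtain ⟨m₁, Φ₁, hΦ₁, hle₁, H₁⟩ := ih1 hΦ hx
    obtain ⟨m₂, Φ₂, hΦ₂, hle₂, H₂⟩ := ih2 hΦ₁ fun l => hle₁ (hx l)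
    refine ⟨m₂, Φ₂, hΦ₂, hle₁.trans hle₂, fun m₃ Φ₃ hle₃ k Ψ hΨ hs => ?_⟩
    obtain ⟨k₁, Ψ₁, hΨ₁, hk₁, hf₁⟩ := H₁ m₃ Φ₃ (hle₂.trans hle₃) k Ψ hΨ hs
    obtain ⟨k₂, Ψ₂, hΨ₂, hk₂, hf₂⟩ := H₂ m₃ Φ₃ hle₃ k₁ Ψ₁ hΨ₁ (hs.trans hk₁)
    exact ⟨k₂, Ψ₂, hΨ₂, hk₁.trans hk₂, Submodule.add_mem _ (hk₂ hf₁) hf₂⟩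
  | smul a _ ih =>
    obtain ⟨m₁, Φ₁, hΦ₁, hle₁, H₁⟩ := ih hΦ hx
    refine ⟨m₁, Φ₁, hΦ₁, hle₁, fun m₂ Φ₂ hle₂ k Ψ hΨ hs => ?_⟩
    obtain ⟨k₁, Ψ₁, hΨ₁, hk₁, hf₁⟩ := H₁ m₂ Φ₂ hle₂ k Ψ hΨ hs
    exact ⟨k₁, Ψ₁, hΨ₁, hk₁, Submodule.smul_mem _ a hf₁⟩
  | relu _ ih =>
    obtain ⟨m₁, Φ₁, hΦ₁, hle₁, H₁⟩ := ih hΦ hx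
    refine ⟨m₁, Φ₁, hΦ₁, hle₁, fun m₂ Φ₂ hle₂ k Ψ hΨ hs => ?_⟩
    obtain ⟨k₁, Ψ₁, hΨ₁, hk₁, hf₁⟩ := H₁ m₂ Φ₂ hle₂ k Ψ hΨ hs
    refine ⟨_, _, hΨ₁.cons hf₁ 0, hk₁.trans (channelSpan_le_cons _ _), ?_⟩
    convert mem_channelSpan_cons Ψ₁ _ using 1
    funext y
    simp

/-- Graph functions are computed by message-passing networks. -/
theorem GraphFunction.exists_mpnn {f : C → ℝ} (hf : GraphFunction A x f) :
    ∃ g : MPNN d, ∀ c, g.apply (A c) (x c) = f c := by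
  obtain ⟨Φ, hΦ, hx⟩ := RFP.exists_isNodeState A x
  obtain ⟨m₁, Φ₁, ⟨⟨L, hL⟩, hpos⟩, -, H⟩ := hf.exists_isGraphState hΦ hx
  -- The readout starts from the vertex sums themselves, nonnegative because `Φ₁` is.
  obtain ⟨k, Ψ, hΨ, -, hmem⟩ := H m₁ Φ₁ le_rfl m₁ (fun c l => ∑ v, Φ₁ (c, v) l)
    ⟨fun g => ⟨g, fun _ => rfl⟩, fun c l => Finset.sum_nonneg fun v _ => hpos _ _⟩ le_rfl
  obtain ⟨w, hw⟩ := mem_channelSpan.1 hmem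
  obtain ⟨ψ, hψ⟩ := hΨ.1 (.output (Matrix.of fun _ => w) 0)
  refine ⟨⟨m₁, L, ψ⟩, fun c => ?_⟩
  simp only [MPNN.apply, hL, Matrix.of_apply, hψ, hw]
  simp [MLP.apply, Matrix.mulVec, dotProduct]

/-- Uniform approximation by message-passing networks, over a compact space on which some vertex
function labels the vertices injectively, of the continuous functions that take equal values at
any two points carried to each other by a relabelling of the vertices. -/
theorem exists_mpnn_approx [TopologicalSpace C] [CompactSpace C] (hA : Continuous A)
    (hx : Continuous x) {ρ : C × Fin n → ℝ} (hρ : NodeFunction A x ρ)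
    (hinj : ∀ c, Function.Injective fun v => ρ (c, v)) (f : C → ℝ) (hf : Continuous f)
    (hinv : ∀ p q, (∃ π : Equiv.Perm (Fin n), (∀ i j, A q (π i) (π j) = A p i j) ∧
      ∀ i l, x q (π i) l = x p i l) → f p = f q) {ε : ℝ} (hε : 0 < ε) :
    ∃ g : MPNN d, ∀ c, |f c - g.apply (A c) (x c)| ≤ ε := by
  have hint : ∀ p q, ∃ g ∈ {g | GraphFunction A x g}, g p = f p ∧ g q = f q := by
    intro p q
    by_cases hpq : f p = f q
    · exact ⟨_, GraphFunction.const (f p), rfl, hpq⟩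
    have : ∃ g, GraphFunction A x g ∧ g p ≠ g q := by
      by_contra! h
      exact hpq (hinv p q (exists_perm_of_graphFunction_eq hρ (hinj p) (hinj q) h))
    obtain ⟨g, hg, hne⟩ := this
    refine ⟨fun c => (f q - f p) / (g q - g p) * (g c - g p) + f p,
      ((hg.sub (.const (g p))).smul _).add (.const (f p)), by simp, ?_⟩
    have : g q - g p ≠ 0 := sub_ne_zero.2 (Ne.symm hne)
    field_simp
    ring
  obtain ⟨g, hg, happ⟩ := exists_uniform_approx_of_lattice {g | GraphFunction A x g}
    (fun g hg => hg.continuous hA hx) (fun g hg g' hg' => hg.max hg')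
    (fun g hg g' hg' => hg.min hg') f hf hint ⟨_, GraphFunction.const 0⟩ hε
  obtain ⟨G, hG⟩ := hg.exists_mpnn
  exact ⟨G, fun c => by rw [hG]; exact happ c⟩

end Generated

/-! ### Random labels -/

/-- The features with entries bounded by `M` and pairwise distances at least `η`. -/
def separatedFeatures (n : ℕ) (M η : ℝ) : Set (Fin n → Fin 1 → ℝ) :=
  {r | (∀ i, |r i 0| ≤ M) ∧ ∀ i j, i ≠ j → η ≤ |r i 0 - r j 0|}

theorem isClosed_separatedFeatures (n : ℕ) (M η : ℝ) : IsClosed (separatedFeatures n M η) := by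
  simp only [separatedFeatures, Set.ofPred_and, Set.ofPred_forall]
  refine (isClosed_iInter fun i => isClosed_le (by fun_prop) (by fun_prop)).inter
    (isClosed_iInter fun i => isClosed_iInter fun j => isClosed_iInter fun _ =>
      isClosed_le (by fun_prop) (by fun_prop))

theorem isCompact_separatedFeatures (n : ℕ) (M η : ℝ) : IsCompact (separatedFeatures n M η) := by
  refine (isCompact_univ_pi (s := fun _ : Fin n => Set.univ.pi fun _ : Fin 1 => Set.Icc (-M) M)
    fun _ => isCompact_univ_pi fun _ => isCompact_Icc).of_isClosed_subset
    (isClosed_separatedFeatures n M η) fun r hr i _ l _ => ?_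
  rw [Subsingleton.elim l 0]
  exact abs_le.1 (hr.1 i)

section Probability

variable (μ : Measure ℝ) [IsProbabilityMeasure μ]

instance (n k : ℕ) : IsProbabilityMeasure (featureLaw μ n k) := by
  unfold featureLaw; infer_instance

theorem measurePreserving_entry (n k : ℕ) (i : Fin n) (l : Fin k) :
    MeasurePreserving (fun r : Fin n → Fin k → ℝ => r i l) (featureLaw μ n k) μ :=
  (measurePreserving_eval (fun _ : Fin k => μ) l).comp
    (measurePreserving_eval (fun _ : Fin n => Measure.pi fun _ : Fin k => μ) i)

/-- By independence the joint law of the two entries is `μ.prod μ`, and every slice of the diagonal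
is a single point, hence null. -/
theorem ae_entry_ne [NullSingletonClass μ] {n k : ℕ} {i j : Fin n} (hij : i ≠ j) (l : Fin k) :
    ∀ᵐ r ∂featureLaw μ n k, r i l ≠ r j l := by
  have hind : ProbabilityTheory.IndepFun (fun r : Fin n → Fin k → ℝ => r i l) (fun r => r j l)
      (featureLaw μ n k) :=
    (ProbabilityTheory.iIndepFun_pi (μ := fun _ : Fin n => Measure.pi fun _ : Fin k => μ)
      (X := fun _ z => z l) fun _ => (measurable_pi_apply l).aemeasurable).indepFun hij
  have hi := measurePreserving_entry μ n k i l
  have hj := measurePreserving_entry μ n k j l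
  have hmap := (ProbabilityTheory.indepFun_iff_map_prod_eq_prod_map_map
    hi.measurable.aemeasurable hj.measurable.aemeasurable).1 hind
  rw [hi.map_eq, hj.map_eq] at hmap
  have hdiag : ∀ᵐ z ∂μ.prod μ, z.1 ≠ z.2 := by
    have hm : MeasurableSet {z : ℝ × ℝ | z.1 = z.2} :=
      measurableSet_eq_fun measurable_fst measurable_snd
    rw [ae_iff]
    simp only [ne_eq, not_not]
    rw [Measure.measure_prod_null hm]
    refine Filter.Eventually.of_forall fun a => ?_
    have : (Prod.mk a ⁻¹' {z : ℝ × ℝ | z.1 = z.2}) = {a} := by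
      ext b
      simp [eq_comm]
    simp [this]
  rw [← hmap] at hdiag
  exact ae_of_ae_map (hi.measurable.prodMk hj.measurable).aemeasurable hdiag

/-- The separated sets increase as the gap shrinks and exhaust almost all bounded features;
continuity of measure from below gives the gap. -/
theorem exists_separatedFeatures [NullSingletonClass μ] (n : ℕ) {M : ℝ}
    (hM : ∀ᵐ t ∂μ, |t| ≤ M) {δ : ℝ} (hδ : 0 < δ) :
    ∃ η > 0, 1 - δ ≤ (featureLaw μ n 1).real (separatedFeatures n M η) := by
  set s : ℕ → Set (Fin n → Fin 1 → ℝ) := fun k => separatedFeatures n M (1 / ((k : ℝ) + 1)) with hs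
  have hmono : Monotone s := fun a b hab r hr =>
    ⟨hr.1, fun i j hij => (one_div_le_one_div_of_le (by positivity) (by
      have : (a : ℝ) ≤ b := by exact_mod_cast hab
      linarith)).trans (hr.2 i j hij)⟩
  have hfull : featureLaw μ n 1 (⋃ k, s k) = 1 := by
    rw [prob_compl_eq_zero_iff₀ ?_ |>.symm]
    · have h1 : ∀ᵐ r ∂featureLaw μ n 1, ∀ i, |r i 0| ≤ M := ae_all_iff.2 fun i =>
        (measurePreserving_entry μ n 1 i 0).quasiMeasurePreserving.ae hM
      have h2 : ∀ᵐ r ∂featureLaw μ n 1, ∀ i j, i ≠ j → r i 0 ≠ r j 0 :=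
        ae_all_iff.2 fun i => ae_all_iff.2 fun j => by
          by_cases hij : i = j
          · simp [hij]
          · filter_upwards [ae_entry_ne μ hij (0 : Fin 1)] with r hr _ using hr
      have h3 : ∀ᵐ r ∂featureLaw μ n 1, r ∈ ⋃ k, s k := by
        filter_upwards [h1, h2] with r hr1 hr2
        have : ∀ᶠ k : ℕ in Filter.atTop, ∀ i j, i ≠ j → 1 / ((k : ℝ) + 1) ≤ |r i 0 - r j 0| := by
          refine Filter.eventually_all.2 fun i => Filter.eventually_all.2 fun j => ?_
          by_cases hij : i = j
          · simp [hij]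
          · filter_upwards [tendsto_one_div_add_atTop_nhds_zero_nat.eventually_le_const
              (abs_pos.2 (sub_ne_zero.2 (hr2 i j hij)))] with k hk _ using hk
        obtain ⟨k, hk⟩ := this.exists
        exact Set.mem_iUnion.2 ⟨k, hr1, hk⟩
      exact h3
    · exact (MeasurableSet.iUnion fun k =>
        (isClosed_separatedFeatures n M _).measurableSet).nullMeasurableSet
  have htend := tendsto_measure_iUnion_atTop (μ := featureLaw μ n 1) hmono
  rw [hfull] at htend
  have htend' : Filter.Tendsto (fun k => (featureLaw μ n 1).real (s k)) Filter.atTop (nhds 1) := by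
    rw [← ENNReal.toReal_one]
    exact (ENNReal.tendsto_toReal ENNReal.one_ne_top).comp htend
  obtain ⟨k, hk⟩ := (htend'.eventually_const_le (show 1 - δ < 1 by linarith)).exists
  exact ⟨1 / ((k : ℝ) + 1), by positivity, hk⟩

end Probability

/-! ### The hyperparameters -/

/-- One unnormalized propagation step with the adjacency matrix, on one random channel. -/
def labelHyperparameters (cin : ℕ) : Hyperparameters where
  op := .adjacency
  normalization := .l2
  -- At least one propagation step is required; with `w = 2` step `1` is not normalized, and
  -- `labelEmbed` gives it weight zero.
  w := 2
  P := 1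
  k := 1
  d := cin + 1
  σ := .identity
  w_pos := by norm_num
  P_pos := le_rfl
  k_pos := le_rfl

/-- The embedding that keeps the input features and the random channel. -/
def labelEmbed (cin : ℕ) :
    Matrix (Fin cin ⊕ Fin (1 + 1) × Fin 1) (Fin (cin + 1)) ℝ :=
  Matrix.of (Sum.elim (fun l => Pi.single l.castSucc 1)
    fun q => if q.1 = 0 then Pi.single (Fin.last cin) 1 else 0)

/-- The node features with the random channel appended. -/
def labelled {n cin : ℕ} (X : Matrix (Fin n) (Fin cin) ℝ) (r : Fin n → Fin 1 → ℝ) :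
    Matrix (Fin n) (Fin (cin + 1)) ℝ :=
  Matrix.of fun v => Fin.snoc (α := fun _ => ℝ) (X v) (r v 0)

theorem initialEmbedding_label {n cin : ℕ} (g : MPNN (cin + 1)) (G : AttrGraph n cin)
    (r : Fin n → Fin 1 → ℝ) :
    initialEmbedding (labelHyperparameters cin) ⟨labelEmbed cin, g⟩ G (Matrix.of r) =
      labelled G.feat r := by
  ext v l
  change (Matrix.fromCols G.feat (trajectory G.adj l2Normalize 2 1 (Matrix.of r)) * labelEmbed cin)
    v l = _
  refine (Matrix.mul_apply ..).trans ?_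
  rw [Fintype.sum_sum_type, Fintype.sum_prod_type]
  refine Fin.lastCases ?_ (fun l => ?_) l
  · simp [labelEmbed, labelled, trajectory, propagate, Fin.sum_univ_succ]
  · simp [labelEmbed, labelled, Fin.sum_univ_succ, Pi.single_apply]

end RFP

end

/-! ### Universal approximation with high probability -/

theorem mainTheorem4 (n cin : ℕ)
    -- a compact set of graphs on `n` vertices, and a continuous graph function on it
    (Ω : Set (RFP.AttrGraph n cin)) (hΩ : IsCompact Ω)
    (f : Ω → ℝ) (hf : Continuous f)
    (hinv : ∀ G G' : Ω, RFP.AttrGraph.Isomorphic G.1 G'.1 → f G = f G')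
    -- a continuous (atomless), bounded distribution with zero mean and finite variance `c`
    (μ : MeasureTheory.Measure ℝ) [MeasureTheory.IsProbabilityMeasure μ]
    [MeasureTheory.NullSingletonClass μ] (hbdd : ∃ M : ℝ, ∀ᵐ x ∂μ, |x| ≤ M)
    (hmean : ∫ x, x ∂μ = 0) (c : ℝ) (hvar : ProbabilityTheory.variance id μ = c)
    (ε δ : ℝ) (hε : 0 < ε) (hδ : 0 < δ) :
    ∃ (H : RFP.Hyperparameters) (W : RFP.Weights cin H), ∀ G : Ω,
      1 - δ ≤ (RFP.featureLaw μ n H.k).real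
        {r | |f G - RFP.output H W G.1 (Matrix.of r)| ≤ ε} := by
  obtain ⟨M, hM⟩ := hbdd
  obtain ⟨η, hη, hprob⟩ := RFP.exists_separatedFeatures μ n hM hδ
  have := isCompact_iff_compactSpace.1 hΩ
  have := isCompact_iff_compactSpace.1 (RFP.isCompact_separatedFeatures n M η)
  have hfeat : Continuous fun p : Ω × RFP.separatedFeatures n M η =>
      RFP.labelled p.1.1.feat p.2.1 := by
    refine continuous_matrix fun v l => ?_
    refine Fin.lastCases ?_ (fun l => ?_) l
    · simp only [RFP.labelled, Matrix.of_apply, Fin.snoc_last]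
      exact (continuous_apply_apply v (0 : Fin 1)).comp
        (continuous_subtype_val.comp continuous_snd)
    · simp only [RFP.labelled, Matrix.of_apply, Fin.snoc_castSucc]
      exact (continuous_snd.comp (continuous_subtype_val.comp
        (continuous_subtype_val.comp continuous_fst))).matrix_elem v l
  have hlast : ∀ (p : Ω × RFP.separatedFeatures n M η) v,
      RFP.labelled p.1.1.feat p.2.1 v (Fin.last cin) = p.2.1 v 0 := by
    simp [RFP.labelled]
  obtain ⟨g, hg⟩ := RFP.exists_mpnn_approx
    (A := fun p : Ω × RFP.separatedFeatures n M η => p.1.1.adj)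
    (x := fun p => RFP.labelled p.1.1.feat p.2.1)
    (continuous_fst.comp (continuous_subtype_val.comp (continuous_subtype_val.comp continuous_fst)))
    hfeat (.channel (Fin.last cin))
    (by
      intro p v w hvw
      by_contra hne
      have h1 := p.2.2.2 v w hne
      simp only [hlast] at hvw
      rw [hvw, sub_self, abs_zero] at h1
      linarith)
    (fun p => f p.1) (hf.comp continuous_fst)
    (by
      rintro p q ⟨π, h1, h2⟩
      -- An isomorphism of labelled graphs remains one after the label channel is forgotten.
      refine hinv _ _ ⟨π, h1, fun i l => ?_⟩
      simpa [RFP.labelled] using h2 i l.castSucc)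
    hε
  refine ⟨RFP.labelHyperparameters cin, ⟨RFP.labelEmbed cin, g⟩, fun G => hprob.trans ?_⟩
  -- For every `G` the good event contains the same set of separated features.
  refine MeasureTheory.measureReal_mono fun r hr => ?_
  have := hg (G, ⟨r, hr⟩)
  rw [← RFP.initialEmbedding_label g] at this
  exact this
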